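/- **Setting.** Let $\mathit{Var}$ be a countably infinite set of quantum variables, each of type Boolean, with state space $\mathcal H_q=\ell^2(\{0,1\})$, or integer, with $\mathcal H_q=\ell^2(\mathbb Z)$. A register $\bar q$ is a finite sequence of distinct variables, with $\mathcal H_{\bar q}=\bigotimes_{q\in\bar q}\mathcal H_q$. The global space $\mathcal H_{\rm all}=\bigotimes_q\mathcal H_q$ is the Hilbert space with orthonormal basis a set $\mathcal B$ of product basis vectors $\bigotimes_q|c_q\rangle$; here $\mathcal B$ may be any nonempty set of such vectors that is closed under changing finitely many components $c_q$ (for example all of them, or those with $c_q=0$ for all but finitely many $q$). An operator $A$ on $\mathcal H_{\bar q}$ is identified with its cylinder extension $A\otimes I$ on $\mathcal H_{\rm all}$. $\mathcal D^-$ is the set of partial density operators on $\mathcal H_{\rm all}$ (positive trace operators $\rho$ with $\operatorname{tr}\rho\le 1$), and $\sqsubseteq$ is the Löwner order. A quantum predicate is an operator $P$ on $\mathcal H_{\rm all}$ with $0\sqsubseteq P\sqsubseteq I$. Infinite sums of operators in predicates and measurements are taken in the strong operator topology. **Programs.** $$S::=\mathbf{skip}\mid q:=0\mid \bar q:=U\bar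 q\mid S_1;S_2\mid \mathbf{measure}\ M[\bar q]:\bar S\mid \mathbf{while}\ M[\bar q]=1\ \mathbf{do}\ S,$$ where $U$ is an operator on $\mathcal H_{\bar q}$ with $U^\dagger U=I$, $M=\{M_m\}$ is a measurement on $\mathcal H_{\bar q}$ (a possibly infinite family with $\sum_m M_m^\dagger M_m=I$), $\bar S=\{S_m\}$ has one program for each outcome $m$, and in the loop $M=\{M_0,M_1\}$. **Semantics.** The transitions between configurations are ($E$ is the empty program, and $E;S_2=S_2$): * $\langle\mathbf{skip},\rho\rangle\to\langle E,\rho\rangle$; * $\langle q:=0,\rho\rangle\to\langle E,\sum_n|0\rangle_q\langle n|\rho|n\rangle_q\langle 0|\rangle$, with $n$ running over the basis labels of $\mathcal H_q$; * $\langle\bar q:=U\bar q,\rho\rangle\to\langle E,U\rho U^\dagger\rangle$; * $\langle S_1;S_2,\rho\rangle\to\langle S_1';S_2,\rho'\rangle$ whenever $\langle S_1,\rho\rangle\to\langle S_1',\rho'\rangle$; * $\langle\mathbf{measure}\ M[\bar q]:\bar S,\rho\rangle\to\langle S_m,M_m\rho M_m^\dagger\rangle$ for each outcome $m$; * $\langle\mathbf{while}\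 M[\bar q]=1\ \mathbf{do}\ S,\rho\rangle\to\langle E,M_0\rho M_0^\dagger\rangle$ and $\to\langle S;\mathbf{while}\ M[\bar q]=1\ \mathbf{do}\ S,\,M_1\rho M_1^\dagger\rangle$. Then $[\![S]\!](\rho)=\sum\{|\rho':\langle S,\rho\rangle\to^*\langle E,\rho'\rangle|\}$, where the multiset has one element for each terminating computation. **Total correctness.** $\models_{\rm tot}\{P\}S\{Q\}$ means that for all $\rho\in\mathcal D^-$ the sum $[\![S]\!](\rho)$ converges to an element of $\mathcal D^-$ and $\operatorname{tr}(P\rho)\le\operatorname{tr}(Q[\![S]\!](\rho))$. **Bound functions.** For an operator $0\sqsubseteq P\sqsubseteq I$ and $\epsilon>0$, a function $t:\mathcal D^-\to\mathbb N$ is a $(P,\epsilon)$-bound function of $\mathbf{while}\ M[\bar q]=1\ \mathbf{do}\ S$ if for all $\rho\in\mathcal D^-$ we have $t([\![S]\!](M_1\rho M_1^\dagger))\le t(\rho)$, and $\operatorname{tr}(P\rho)\ge\epsilon$ implies $t([\![S]\!](M_1\rho M_1^\dagger))<t(\rho)$. **The proof system $qTD$.** All pre- and postconditions are quantum predicates.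 The axioms and rules are: * $\{P\}\,\mathbf{skip}\,\{P\}$; * $\{\sum_n|n\rangle_q\langle0|P|0\rangle_q\langle n|\}\ q:=0\ \{P\}$; * $\{U^\dagger PU\}\ \bar q:=U\bar q\ \{P\}$; * from $\{P\}S_1\{Q\}$ and $\{Q\}S_2\{R\}$ infer $\{P\}S_1;S_2\{R\}$; * from $\{P_m\}S_m\{Q\}$ for all $m$ infer $\{\sum_mM_m^\dagger P_mM_m\}\ \mathbf{measure}\ M[\bar q]:\bar S\ \{Q\}$; * if for every $\epsilon>0$ there is an $(M_1^\dagger QM_1,\epsilon)$-bound function of $\mathbf{while}\ M[\bar q]=1\ \mathbf{do}\ S$, then from $\{Q\}S\{M_0^\dagger PM_0+M_1^\dagger QM_1\}$ infer $\{M_0^\dagger PM_0+M_1^\dagger QM_1\}\ \mathbf{while}\ M[\bar q]=1\ \mathbf{do}\ S\ \{P\}$; * from $P\sqsubseteq P'$, $\{P'\}S\{Q'\}$ and $Q'\sqsubseteq Q$ infer $\{P\}S\{Q\}$. **Theorem (Soundness of $qTD$).** For every quantum program $S$ and all quantum predicates $P,Q$ on $\mathcal H_{\rm all}$, if $\{P\}S\{Q\}$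 is derivable in $qTD$, then $\models_{\rm tot}\{P\}S\{Q\}$. -/

import Mathlib

namespace QHoare

open scoped InnerProduct

noncomputable section

/-! ### Types, variables, registers and their state spaces -/

/-- The two basic types of quantum variables. -/
inductive QType where
  | boolean
  | integer

/-- The labels of the computational basis of the space denoted by a type. -/
def QType.Dom : QType → Type
  | .boolean => Fin 2
  | .integer => ℤ

/-- The label of the basis vector `|0⟩`. -/
def QType.zero : (t : QType) → t.Dom
  | .boolean => (0 : Fin 2)
  | .integer => (0 : ℤ)

/-- The Hilbert space `ℓ²(α)` of square summable families, with computational basis labelled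
by `α`. So `ℓ²(Fin 2)` and `ℓ²(ℤ)` are the spaces of the types Boolean and integer. -/
abbrev L2 (α : Type) : Type := lp (fun _ : α => ℂ) 2

/-- Bounded operators on `ℓ²(α)`. -/
abbrev Op (α : Type) : Type := L2 α →L[ℂ] L2 α

open Classical in
/-- The computational basis vector `|x⟩`. -/
def ket {α : Type} (x : α) : L2 α := lp.single 2 x (1 : ℂ)

/-- The operator `|x⟩⟨y|`. -/
def ketBra {α : Type} (x y : α) : Op α := (innerSL ℂ (ket y)).smulRight (ket x)

/-- A quantum register: a finite sequence of distinct quantum variables. -/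
structure Register (Var : Type) where
  vars : List Var
  nodup : vars.Nodup

/-- The register consisting of one variable. -/
def Register.single {Var : Type} (q : Var) : Register Var := ⟨[q], List.nodup_singleton q⟩

variable {Var : Type} {ty : Var → QType}

/-- The computational (product) basis of the state space of a register: a basis label for each of
its variables. The state space `⨂_{q ∈ r} H_q` is `L2 (r.Idx ty)`. -/
def Register.Idx (r : Register Var) (ty : Var → QType) : Type :=
  ∀ q : {q : Var // q ∈ r.vars}, (ty q).Dom

/-- The label of `|0⟩ ⊗ ... ⊗ |0⟩`. -/
def Register.zero (r : Register Var) (ty : Var → QType) : r.Idx ty := fun q => (ty q).zero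

/-- A set of product basis vectors `⨂_q |c q⟩` of the tensor product of the state spaces of all
variables: a nonempty set of assignments `c` that is closed under changing finitely many
components. The set of all assignments, and the (countable, if `Var` is) set of those that
are `0` at all but finitely many variables, are the two main examples. -/
structure ProductBasis (ty : Var → QType) where
  carrier : Set (∀ q, (ty q).Dom)
  nonempty : carrier.Nonempty
  closed : ∀ c ∈ carrier, ∀ c' : (∀ q, (ty q).Dom), {q | c' q ≠ c q}.Finite → c' ∈ carrier

/-- The index type of the product basis. The global state space `H_all`, spanned by the
product basis, is `L2 B.Idx`. -/
abbrev ProductBasis.Idx (B : ProductBasis ty) : Type := ↥B.carrier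

/-! ### Cylinder extensions -/

/-- For a splitting `κ ≃ α × δ` of the basis, i.e. `ℓ²(κ) = ℓ²(α) ⊗ ℓ²(δ)`, the component
`(1 ⊗ ⟨d|) ψ` of `ψ`. -/
def slice {κ α δ : Type} (e : κ ≃ α × δ) (d : δ) (ψ : L2 κ) : L2 α :=
  ⟨fun x => ψ (e.symm (x, d)), by
    apply memℓp_gen
    have h := (lp.memℓp ψ).summable (by norm_num)
    exact h.comp_injective (i := fun x => e.symm (x, d))
      (fun x y hxy => by simpa using hxy)⟩

theorem slice_apply {κ α δ : Type} (e : κ ≃ α × δ) (d : δ) (ψ : L2 κ) (x : α) :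
    slice e d ψ x = ψ (e.symm (x, d)) := rfl

theorem slice_add {κ α δ : Type} (e : κ ≃ α × δ) (d : δ) (ψ φ : L2 κ) :
    slice e d (ψ + φ) = slice e d ψ + slice e d φ := rfl

theorem slice_smul {κ α δ : Type} (e : κ ≃ α × δ) (d : δ) (a : ℂ) (ψ : L2 κ) :
    slice e d (a • ψ) = a • slice e d ψ := rfl

theorem hasSum_sq {α : Type} (ψ : L2 α) : HasSum (fun x => ‖ψ x‖ ^ 2) (‖ψ‖ ^ 2) := by
  have h := lp.hasSum_norm (p := 2) (by norm_num) ψ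
  simpa using h

theorem hasSum_slice {κ α δ : Type} (e : κ ≃ α × δ) (ψ : L2 κ) :
    HasSum (fun d => ‖slice e d ψ‖ ^ 2) (‖ψ‖ ^ 2) := by
  have h := hasSum_sq ψ
  rw [← (((Equiv.prodComm δ α).trans e.symm).hasSum_iff)] at h
  exact h.prod_fiberwise (fun d => hasSum_sq (slice e d ψ))

theorem extend_bound {κ α δ : Type} (e : κ ≃ α × δ) (A : Op α) (ψ : L2 κ) :
    ∃ s, s ≤ (‖A‖ * ‖ψ‖) ^ 2 ∧
      HasSum (fun k => ‖A (slice e (e k).2 ψ) (e k).1‖ ^ 2) s := by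
  have h1 : ∀ d, ‖A (slice e d ψ)‖ ^ 2 ≤ ‖A‖ ^ 2 * ‖slice e d ψ‖ ^ 2 := fun d => by
    rw [← mul_pow]
    exact pow_le_pow_left₀ (norm_nonneg _) (A.le_opNorm _) 2
  have h2 := (hasSum_slice e ψ).mul_left (‖A‖ ^ 2)
  have h3 : Summable fun d => ‖A (slice e d ψ)‖ ^ 2 :=
    Summable.of_nonneg_of_le (fun d => by positivity) h1 h2.summable
  have h4 : Summable fun p : δ × α => ‖A (slice e p.1 ψ) p.2‖ ^ 2 := by
    rw [summable_prod_of_nonneg (fun p => by positivity)]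
    refine ⟨fun d => (hasSum_sq (A (slice e d ψ))).summable, ?_⟩
    simpa only [(hasSum_sq (A (slice e _ ψ))).tsum_eq] using h3
  refine ⟨∑' d, ‖A (slice e d ψ)‖ ^ 2, ?_, ?_⟩
  · rw [mul_pow, ← h2.tsum_eq]
    exact h3.tsum_le_tsum h1 h2.summable
  · have h5 := h4.hasSum
    have h6 := h5.prod_fiberwise (fun d => hasSum_sq (A (slice e d ψ)))
    rw [h6.tsum_eq]
    have h7 := ((e.trans (Equiv.prodComm α δ)).hasSum_iff).2 h5
    exact h7

/-- The operator `A ⊗ 1` on `ℓ²(κ) = ℓ²(α) ⊗ ℓ²(δ)`: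
`(1 ⊗ ⟨d|) (A ⊗ 1) ψ = A ((1 ⊗ ⟨d|) ψ)` for every `d`. -/
def extend {κ α δ : Type} (e : κ ≃ α × δ) (A : Op α) : Op κ :=
  LinearMap.mkContinuous
    { toFun := fun ψ => ⟨fun k => A (slice e (e k).2 ψ) (e k).1, by
        obtain ⟨s, -, hs⟩ := extend_bound e A ψ
        apply memℓp_gen
        simpa using hs.summable⟩
      map_add' := fun ψ φ => by
        ext k
        simp only [slice_add, map_add]
        rfl
      map_smul' := fun a ψ => by
        ext k
        simp only [slice_smul, map_smul]
        rfl }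
    ‖A‖ (fun ψ => by
      obtain ⟨s, hle, hs⟩ := extend_bound e A ψ
      refine le_of_sq_le_sq ?_ (by positivity)
      refine le_trans (le_of_eq ?_) hle
      exact (hasSum_sq _).unique hs)

variable (B : ProductBasis ty)

/-- Basis labels of the variables outside the register `r`. -/
abbrev ProductBasis.Rest (r : Register Var) : Type :=
  ↥(Set.range fun (c : B.Idx) (q : {q : Var // q ∉ r.vars}) => c.1 q)

open Classical in
/-- The assignment that is `x` on the register `r` and `d` outside of it. -/
def glue (r : Register Var) (x : r.Idx ty) (d : ∀ q : {q : Var // q ∉ r.vars}, (ty q).Dom) :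
    ∀ q, (ty q).Dom :=
  fun q => if h : q ∈ r.vars then x ⟨q, h⟩ else d ⟨q, h⟩

/-- The splitting of the product basis of `H_all` into the register `r` and the rest. -/
def ProductBasis.split (r : Register Var) : B.Idx ≃ r.Idx ty × B.Rest r where
  toFun c := (fun q => c.1 q, ⟨fun q => c.1 q, c, rfl⟩)
  invFun p := ⟨glue r p.1 p.2.1, by
    obtain ⟨x, d, c, rfl⟩ := p
    refine B.closed c.1 c.2 _ ((List.finite_toSet r.vars).subset fun q hq => ?_)
    by_contra h
    exact hq (by simp only [glue]; exact dif_neg h)⟩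
  left_inv c := by
    apply Subtype.ext
    funext q
    simp [glue]
  right_inv p := by
    obtain ⟨x, d, c, rfl⟩ := p
    refine Prod.ext ?_ (Subtype.ext ?_)
    · funext q
      simp [glue, q.2]
    · funext q
      simp [glue, q.2]

/-- The cylinder extension `A ⊗ 1` to `H_all` of an operator `A` on the space of a register. -/
def cyl (r : Register Var) (A : Op (r.Idx ty)) : Op B.Idx := extend (B.split r) A

/-! ### Trace, partial density operators, quantum predicates -/

/-- `A` is a trace operator: the diagonal of `A` is summable in every orthonormal basis. -/
def IsTraceOperator {α : Type} (A : Op α) : Prop :=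
  ∀ (ι : Type) (b : HilbertBasis ι ℂ (L2 α)), Summable fun i => inner ℂ (b i) (A (b i))

/-- The trace of `A`, computed in the computational basis. -/
def tr {α : Type} (A : Op α) : ℂ := ∑' x, inner ℂ (ket x) (A (ket x))

/-- Partial density operators: positive trace operators of trace at most `1`. -/
def IsPartialDensity {α : Type} (ρ : Op α) : Prop :=
  ρ.IsPositive ∧ IsTraceOperator ρ ∧ (tr ρ).re ≤ 1

/-- The set `D⁻(H_all)`. -/
abbrev PartialDensity : Type := {ρ : Op B.Idx // IsPartialDensity ρ}

/-- Quantum predicates on `H_all`: operators `0 ⊑ P ⊑ 1` in the Löwner order (which is the order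
of bounded operators here; it makes `P` Hermitian). -/
abbrev Predicate : Type := {P : Op B.Idx // 0 ≤ P ∧ P ≤ 1}

/-- `T` is the sum of the operators `f i` in the strong operator topology. -/
def HasStrongSum {α ι : Type} (f : ι → Op α) (T : Op α) : Prop :=
  ∀ ψ, HasSum (fun i => f i ψ) (T ψ)

/-! ### Quantum programs -/

/-- A quantum measurement with outcomes in `O`: operators with `∑ m, M_m† M_m = 1`. -/
structure Measurement (α O : Type) where
  op : O → Op α
  complete : HasStrongSum (fun m => (op m)† ∘L op m) 1

/-- Quantum while-programs. -/
inductive Prog (ty : Var → QType) : Type 1 where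
  /-- `skip` -/
  | skip : Prog ty
  /-- `q := 0` -/
  | init (q : Var) : Prog ty
  /-- `r := U r`, with `U† U = 1` -/
  | unitary (r : Register Var) (U : Op (r.Idx ty)) (hU : U† ∘L U = 1) : Prog ty
  /-- `S₁ ; S₂` -/
  | seq (S₁ S₂ : Prog ty) : Prog ty
  /-- `measure M[r] : S`, with one program `S m` for each outcome `m` -/
  | measure (r : Register Var) {O : Type} (M : Measurement (r.Idx ty) O) (S : O → Prog ty) :
      Prog ty
  /-- `while M[r] = 1 do S`, with a yes-no measurement `M` -/
  | loop (r : Register Var) (M : Measurement (r.Idx ty) (Fin 2)) (S : Prog ty) : Prog ty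

/-! ### Operational and denotational semantics -/

/-- The operator `|x⟩_q⟨y|` on `H_all`. -/
def ketBraAt (q : Var) (x y : (Register.single q).Idx ty) : Op B.Idx :=
  cyl B (Register.single q) (ketBra x y)

/-- The state `∑ x, |0⟩_q⟨x| ρ |x⟩_q⟨0|` after initialization of `q`, where `x` runs through the
computational basis of `H_q`. -/
def initState (q : Var) (ρ : Op B.Idx) : Op B.Idx :=
  ∑' x : (Register.single q).Idx ty,
    ketBraAt B q (Register.zero _ ty) x ∘L ρ ∘L ketBraAt B q x (Register.zero _ ty)

/-- Remainder of `S₁ ; S₂` after a step of `S₁`, with the convention `E ; S₂ = S₂` (`none` is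
the empty program `E`). -/
def Prog.andThen : Option (Prog ty) → Prog ty → Prog ty
  | none, S₂ => S₂
  | some S₁, S₂ => .seq S₁ S₂

/-- The transition relation `⟨S, ρ⟩ → ⟨S', ρ'⟩`; `S' = none` is the empty program. It takes values
in types, not in propositions: different outcomes of a measurement are different
transitions even if they lead to the same configuration. -/
inductive Step : Prog ty → Op B.Idx → Option (Prog ty) → Op B.Idx → Type 1 where
  | skip (ρ : Op B.Idx) : Step .skip ρ none ρ
  | init (q : Var) (ρ : Op B.Idx) : Step (.init q) ρ none (initState B q ρ)
  | unitary (r : Register Var) (U : Op (r.Idx ty)) (hU : U† ∘L U = 1) (ρ : Op B.Idx) :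
      Step (.unitary r U hU) ρ none (cyl B r U ∘L ρ ∘L (cyl B r U)†)
  | seq {S₁ : Prog ty} {ρ : Op B.Idx} {S₁' : Option (Prog ty)} {ρ' : Op B.Idx} (S₂ : Prog ty)
      (h : Step S₁ ρ S₁' ρ') : Step (.seq S₁ S₂) ρ (some (Prog.andThen S₁' S₂)) ρ'
  | measure (r : Register Var) {O : Type} (M : Measurement (r.Idx ty) O) (S : O → Prog ty)
      (ρ : Op B.Idx) (m : O) :
      Step (.measure r M S) ρ (some (S m)) (cyl B r (M.op m) ∘L ρ ∘L (cyl B r (M.op m))†)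
  | loop0 (r : Register Var) (M : Measurement (r.Idx ty) (Fin 2)) (S : Prog ty) (ρ : Op B.Idx) :
      Step (.loop r M S) ρ none (cyl B r (M.op 0) ∘L ρ ∘L (cyl B r (M.op 0))†)
  | loop1 (r : Register Var) (M : Measurement (r.Idx ty) (Fin 2)) (S : Prog ty) (ρ : Op B.Idx) :
      Step (.loop r M S) ρ (some (.seq S (.loop r M S)))
        (cyl B r (M.op 1) ∘L ρ ∘L (cyl B r (M.op 1))†)

/-- Finite transition sequences `⟨S, ρ⟩ →* ⟨S', ρ'⟩`. -/
inductive Steps : Option (Prog ty) → Op B.Idx → Option (Prog ty) → Op B.Idx → Type 1 where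
  | refl (S : Option (Prog ty)) (ρ : Op B.Idx) : Steps S ρ S ρ
  | head {S : Prog ty} {ρ : Op B.Idx} {S' : Option (Prog ty)} {ρ' : Op B.Idx}
      {S'' : Option (Prog ty)} {ρ'' : Op B.Idx}
      (h : Step B S ρ S' ρ') (t : Steps S' ρ' S'' ρ'') : Steps (some S) ρ S'' ρ''

/-- The terminating computations of `S` starting in `ρ`, with their final states. -/
abbrev Terminating (S : Prog ty) (ρ : Op B.Idx) : Type 1 :=
  Σ ρ' : Op B.Idx, Steps B (some S) ρ none ρ'

/-- The semantic function `⟦S⟧(ρ) = ∑ {| ρ' : ⟨S, ρ⟩ →* ⟨E, ρ'⟩ |}`: the sum over the multiset of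
the final states of all terminating computations. -/
def sem (S : Prog ty) (ρ : Op B.Idx) : Op B.Idx := ∑' x : Terminating B S ρ, x.1

/-! ### Correctness and the proof system for total correctness -/

variable {B}

/-- Total correctness of `{P} S {Q}`: for all partial density operators `ρ`, the sum that defines
`⟦S⟧(ρ)` converges to a partial density operator and `tr(P ρ) ≤ tr(Q ⟦S⟧(ρ))`. -/
def TotallyCorrect (P : Predicate B) (S : Prog ty) (Q : Predicate B) : Prop :=
  ∀ ρ : PartialDensity B,
    (Summable fun x : Terminating B S ρ.1 => x.1) ∧ IsPartialDensity (sem B S ρ.1) ∧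
      (tr (P.1 ∘L ρ.1)).re ≤ (tr (Q.1 ∘L sem B S ρ.1)).re

/-- `t` is a `(P, ε)`-bound function of the loop `while M[r] = 1 do S`. (The partial density
operator `σ` stands for `⟦S⟧(M₁ ρ M₁†)`.) -/
def IsBoundFunction (r : Register Var) (M : Measurement (r.Idx ty) (Fin 2)) (S : Prog ty)
    (P : Op B.Idx) (ε : ℝ) (t : PartialDensity B → ℕ) : Prop :=
  ∀ ρ σ : PartialDensity B,
    σ.1 = sem B S (cyl B r (M.op 1) ∘L ρ.1 ∘L (cyl B r (M.op 1))†) →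
      t σ ≤ t ρ ∧ (ε ≤ (tr (P ∘L ρ.1)).re → t σ < t ρ)

/-- Derivability of the correctness formula `{P} S {Q}` in the proof system `qTD`. -/
inductive Derivable : Predicate B → Prog ty → Predicate B → Prop where
  | skip (P : Predicate B) : Derivable P .skip P
  | init (q : Var) (P P' : Predicate B)
      (hP' : HasStrongSum (fun x : (Register.single q).Idx ty =>
        ketBraAt B q x (Register.zero _ ty) ∘L P.1 ∘L ketBraAt B q (Register.zero _ ty) x) P'.1) :
      Derivable P' (.init q) P
  | unitary (r : Register Var) (U : Op (r.Idx ty)) (hU : U† ∘L U = 1) (P P' : Predicate B)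
      (hP' : P'.1 = (cyl B r U)† ∘L P.1 ∘L cyl B r U) :
      Derivable P' (.unitary r U hU) P
  | seq (S₁ S₂ : Prog ty) (P Q R : Predicate B) (h₁ : Derivable P S₁ Q) (h₂ : Derivable Q S₂ R) :
      Derivable P (.seq S₁ S₂) R
  | measure (r : Register Var) {O : Type} (M : Measurement (r.Idx ty) O) (S : O → Prog ty)
      (P : O → Predicate B) (P' Q : Predicate B) (h : ∀ m, Derivable (P m) (S m) Q)
      (hP' : HasStrongSum
        (fun m => (cyl B r (M.op m))† ∘L (P m).1 ∘L cyl B r (M.op m)) P'.1) :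
      Derivable P' (.measure r M S) Q
  | loop (r : Register Var) (M : Measurement (r.Idx ty) (Fin 2)) (S : Prog ty)
      (P Q R : Predicate B)
      (hR : R.1 = (cyl B r (M.op 0))† ∘L P.1 ∘L cyl B r (M.op 0) +
        (cyl B r (M.op 1))† ∘L Q.1 ∘L cyl B r (M.op 1))
      (h : Derivable Q S R)
      (ht : ∀ ε : ℝ, 0 < ε → ∃ t : PartialDensity B → ℕ,
        IsBoundFunction r M S ((cyl B r (M.op 1))† ∘L Q.1 ∘L cyl B r (M.op 1)) ε t) :
      Derivable R (.loop r M S) P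
  | order (S : Prog ty) (P P' Q Q' : Predicate B) (hP : P.1 ≤ P'.1) (h : Derivable P' S Q')
      (hQ : Q'.1 ≤ Q.1) : Derivable P S Q

end

end QHoare

/-! Total correctness is proved through the expectation `expect P ρ`, which is tr(Pρ) written as the
squared Hilbert–Schmidt norm of √ρ√P, with values in [0,∞]. There every infinite sum exists and sums
may be exchanged freely. The formula is additive in ρ, its mirror image (`expect_eq_tsum_root`) is
additive in P, and `expect_conj` moves an operator from the state to the predicate. `re_tr_comp` and
`isPartialDensity_iff` translate back to traces and to partial density operators.

The terminating computations from ρ form a type that depends on ρ. They are reindexed by label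
sequences (`Path`), which do not depend on ρ, so ⟦S⟧(ρ) becomes a sum over a fixed index set. One
step preserves the total trace, so all paths together have trace at most that of ρ. Since the
operator norm of a positive operator is at most its trace, the sum converges absolutely. A path acts
by a Kraus family and so commutes with such sums; with injectivity of concatenation this gives
`expect_sem_sem_le`, the lower bound for `S; T`.

The rules follow by induction on derivations, and only the loop is hard (`expectCorrect_loop`). Fix
ε and a bound function t. While the expectation of Q after entering the body exceeds ε, one more
iteration strictly lowers t, so after finitely many iterations it is at most ε. Dropping it there
costs ε once, and ε is arbitrary. -/

namespace QHoare

open scoped InnerProduct ENNReal ComplexOrder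

noncomputable section

/-! ### Square roots and Hilbert–Schmidt norms -/

section Hilbert

variable {E : Type*} [NormedAddCommGroup E] [InnerProductSpace ℂ E] [CompleteSpace E]

/-- The positive square root of a positive operator. -/
def root (A : E →L[ℂ] E) : E →L[ℂ] E := CFC.sqrt A

theorem root_adjoint (A : E →L[ℂ] E) : (root A)† = root A :=
  (IsSelfAdjoint.of_nonneg (CFC.sqrt_nonneg A)).star_eq

theorem root_comp_root {A : E →L[ℂ] E} (h : 0 ≤ A) : root A ∘L root A = A :=
  CFC.sqrt_mul_sqrt_self A h

/-- The real number `⟨v, A v⟩`, for positive `A`, as an extended nonnegative real. -/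
def quadForm (A : E →L[ℂ] E) (v : E) : ℝ≥0∞ := ENNReal.ofReal (inner ℂ v (A v)).re

theorem ofReal_norm_sq {F : Type*} [SeminormedAddCommGroup F] (v : F) :
    ENNReal.ofReal (‖v‖ ^ 2) = ‖v‖ₑ ^ 2 := by
  rw [ENNReal.ofReal_pow (norm_nonneg _), ofReal_norm]

omit [CompleteSpace E] in
theorem re_inner_nonneg {A : E →L[ℂ] E} (h : 0 ≤ A) (v : E) : 0 ≤ (inner ℂ v (A v)).re := by
  have := ((ContinuousLinearMap.nonneg_iff_isPositive A).1 h).re_inner_nonneg_right v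
  simpa using this

theorem quadForm_adjoint_comp (K : E →L[ℂ] E) (v : E) :
    quadForm (K† ∘L K) v = ‖K v‖ₑ ^ 2 := by
  rw [quadForm, ContinuousLinearMap.comp_apply, ContinuousLinearMap.adjoint_inner_right,
    ← ofReal_norm_sq, inner_self_eq_norm_sq_to_K]
  norm_cast

theorem quadForm_eq_root {A : E →L[ℂ] E} (h : 0 ≤ A) (v : E) :
    quadForm A v = ‖root A v‖ₑ ^ 2 := by
  conv_lhs => rw [← root_comp_root h]
  nth_rw 1 [← root_adjoint A]
  rw [quadForm_adjoint_comp]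

theorem quadForm_conj (A K : E →L[ℂ] E) (v : E) :
    quadForm (K† ∘L A ∘L K) v = quadForm A (K v) := by
  simp only [quadForm, ContinuousLinearMap.comp_apply, ContinuousLinearMap.adjoint_inner_right]

theorem quadForm_mono {A A' : E →L[ℂ] E} (h : A ≤ A') (v : E) : quadForm A v ≤ quadForm A' v := by
  refine ENNReal.ofReal_le_ofReal ?_
  have := re_inner_nonneg (sub_nonneg.2 h) v
  simpa [inner_sub_right] using this

omit [CompleteSpace E] in
theorem quadForm_add {A A' : E →L[ℂ] E} (h : 0 ≤ A) (h' : 0 ≤ A') (v : E) :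
    quadForm (A + A') v = quadForm A v + quadForm A' v := by
  rw [quadForm, quadForm, quadForm,
    ← ENNReal.ofReal_add (re_inner_nonneg h v) (re_inner_nonneg h' v)]
  simp

omit [CompleteSpace E] in
theorem quadForm_hasSum {ι : Type*} {f : ι → E →L[ℂ] E} {T : E →L[ℂ] E} (hf : ∀ i, 0 ≤ f i)
    {v : E} (h : HasSum (fun i => f i v) (T v)) : quadForm T v = ∑' i, quadForm (f i) v := by
  have h1 := Complex.reCLM.hasSum ((innerSL ℂ v).hasSum h)
  simp only [quadForm]
  rw [← ENNReal.ofReal_tsum_of_nonneg (fun i => re_inner_nonneg (hf i) v)]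
  · congr 1
    exact h1.tsum_eq.symm
  · exact h1.summable

theorem conj_nonneg {A : E →L[ℂ] E} (h : 0 ≤ A) (K : E →L[ℂ] E) : 0 ≤ K ∘L A ∘L K† := by
  rw [ContinuousLinearMap.nonneg_iff_isPositive] at *
  exact h.conj_adjoint K

theorem conj_nonneg' {A : E →L[ℂ] E} (h : 0 ≤ A) (K : E →L[ℂ] E) : 0 ≤ K† ∘L A ∘L K := by
  simpa using conj_nonneg h (K†)

omit [CompleteSpace E] in
theorem nonneg_of_re_inner {A : E →L[ℂ] E} (h : ∀ v, 0 ≤ inner ℂ v (A v)) : 0 ≤ A := by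
  rw [ContinuousLinearMap.nonneg_iff_isPositive, ContinuousLinearMap.isPositive_iff_complex]
  intro v
  have h1 : 0 ≤ inner ℂ (A v) v := by
    rw [← inner_conj_symm]
    exact star_nonneg_iff.2 (h v)
  rw [Complex.le_def] at h1
  refine ⟨?_, ?_⟩
  · apply Complex.ext
    · simp
    · simpa using h1.2
  · simpa using h1.1

omit [CompleteSpace E] in
theorem parseval {ι : Type*} (b : HilbertBasis ι ℂ E) (v : E) :
    ∑' i, ‖inner ℂ (b i) v‖ₑ ^ 2 = ‖v‖ₑ ^ 2 := by
  have h := lp.hasSum_norm (p := 2) (by norm_num) (b.repr v)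
  simp only [ENNReal.toReal_ofNat, Real.rpow_ofNat, LinearIsometryEquiv.norm_map,
    b.repr_apply_apply] at h
  simp only [← ofReal_norm_sq]
  rw [← h.tsum_eq, ENNReal.ofReal_tsum_of_nonneg (fun i => by positivity) h.summable]

/-- By Parseval both sides sum the squared moduli of the same matrix entries, by columns and by
rows. -/
theorem tsum_enorm_sq_adjoint {ι κ : Type*} (b : HilbertBasis ι ℂ E) (c : HilbertBasis κ ℂ E)
    (T : E →L[ℂ] E) : ∑' i, ‖T (b i)‖ₑ ^ 2 = ∑' j, ‖(T†) (c j)‖ₑ ^ 2 := by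
  simp_rw [← parseval c (T _), ← parseval b ((T†) _)]
  rw [ENNReal.tsum_comm]
  refine tsum_congr fun j => tsum_congr fun i => ?_
  rw [ContinuousLinearMap.adjoint_inner_right, ← inner_conj_symm, RCLike.enorm_conj]

end Hilbert

/-- The computational basis as a Hilbert basis. -/
def ketBasis (α : Type) : HilbertBasis α ℂ (L2 α) := ⟨LinearIsometryEquiv.refl ℂ _⟩

theorem ketBasis_apply {α : Type} (x : α) : ketBasis α x = ket x := by
  classical
  exact ((ketBasis α).repr_symm_single x).symm

variable {α : Type}

/-- The square of the Hilbert–Schmidt norm. -/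
def hs (T : Op α) : ℝ≥0∞ := ∑' x, ‖T (ket x)‖ₑ ^ 2

/-- The arbitrary basis `b` is what later makes the trace of a positive operator basis independent.
-/
theorem hs_eq_tsum_adjoint {ι : Type} (b : HilbertBasis ι ℂ (L2 α)) (T : Op α) :
    hs T = ∑' i, ‖(T†) (b i)‖ₑ ^ 2 := by
  simpa only [ketBasis_apply, hs] using tsum_enorm_sq_adjoint (ketBasis α) b T

theorem hs_adjoint (T : Op α) : hs (T†) = hs T := by
  rw [hs_eq_tsum_adjoint (ketBasis α) T]
  simp only [ketBasis_apply, hs]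

theorem enorm_apply_sq_le_hs (T : Op α) (v : L2 α) : ‖T v‖ₑ ^ 2 ≤ hs T * ‖v‖ₑ ^ 2 := by
  rw [← hs_adjoint, hs, ← parseval (ketBasis α), ← ENNReal.tsum_mul_right]
  refine ENNReal.tsum_le_tsum fun x => ?_
  rw [ketBasis_apply, ← ContinuousLinearMap.adjoint_inner_left, ← mul_pow]
  gcongr
  simp only [← ofReal_norm]
  rw [← ENNReal.ofReal_mul (norm_nonneg _)]
  exact ENNReal.ofReal_le_ofReal (norm_inner_le_norm _ _)

theorem enorm_sq_le_hs (T : Op α) : ‖T‖ₑ ^ 2 ≤ hs T := by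
  by_cases h : hs T = ∞
  · simp [h]
  rw [← ENNReal.ofReal_toReal h, ← ofReal_norm_sq]
  apply ENNReal.ofReal_le_ofReal
  rw [← Real.le_sqrt (norm_nonneg _) ENNReal.toReal_nonneg]
  refine T.opNorm_le_bound (Real.sqrt_nonneg _) fun v => ?_
  refine le_of_sq_le_sq ?_ (by positivity)
  rw [mul_pow, Real.sq_sqrt ENNReal.toReal_nonneg]
  have := enorm_apply_sq_le_hs T v
  rw [← ofReal_norm_sq, ← ofReal_norm_sq] at this
  rwa [← ENNReal.ofReal_toReal h, ← ENNReal.ofReal_mul ENNReal.toReal_nonneg,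
    ENNReal.ofReal_le_ofReal_iff (by positivity)] at this

theorem hs_comp_le (A T : Op α) : hs (A ∘L T) ≤ ‖A‖ₑ ^ 2 * hs T := by
  rw [hs, hs, ← ENNReal.tsum_mul_left]
  refine ENNReal.tsum_le_tsum fun x => ?_
  rw [← mul_pow]
  gcongr
  exact A.le_opENorm _

theorem summable_norm_sq_of_hs {T : Op α} (h : hs T ≠ ∞) : Summable fun x => ‖T (ket x)‖ ^ 2 := by
  have := ENNReal.summable_toReal h
  refine this.congr fun x => ?_
  rw [← ofReal_norm_sq, ENNReal.toReal_ofReal (by positivity)]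

theorem summable_inner_inner {A C : Op α} (hA : hs A ≠ ∞) (hC : hs C ≠ ∞) :
    Summable fun p : α × α =>
      inner ℂ (A (ket p.1)) (ket p.2) * inner ℂ (ket p.2) (C (ket p.1)) := by
  have key : ∀ T : Op α, hs T ≠ ∞ →
      Summable fun p : α × α => ‖inner ℂ (ket p.2) (T (ket p.1))‖ ^ 2 := by
    intro T hT
    have h1 : ∑' p : α × α, ‖inner ℂ (ket p.2) (T (ket p.1))‖ₑ ^ 2 ≠ ∞ := by
      rw [ENNReal.tsum_prod (f := fun x y => ‖inner ℂ (ket y) (T (ket x))‖ₑ ^ 2)]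
      simpa only [← ketBasis_apply, parseval, hs] using hT
    refine (ENNReal.summable_toReal h1).congr fun p => ?_
    rw [← ofReal_norm_sq, ENNReal.toReal_ofReal (by positivity)]
  refine Summable.of_norm_bounded ((key A hA).add (key C hC)) fun p => ?_
  rw [norm_mul, ← inner_conj_symm, RCLike.norm_conj]
  nlinarith [sq_nonneg (‖inner ℂ (ket p.2) (A (ket p.1))‖ - ‖inner ℂ (ket p.2) (C (ket p.1))‖),
    norm_nonneg (inner ℂ (ket p.2) (A (ket p.1))), norm_nonneg (inner ℂ (ket p.2) (C (ket p.1)))]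

/-- Cyclicity of the trace for products of Hilbert–Schmidt operators. -/
theorem tsum_inner_adjoint {A C : Op α} (hA : hs A ≠ ∞) (hC : hs C ≠ ∞) :
    ∑' x, inner ℂ (A (ket x)) (C (ket x)) = ∑' y, inner ℂ ((C†) (ket y)) ((A†) (ket y)) := by
  have h1 : ∀ x, inner ℂ (A (ket x)) (C (ket x)) =
      ∑' y, inner ℂ (A (ket x)) (ket y) * inner ℂ (ket y) (C (ket x)) := fun x => by
    simpa only [ketBasis_apply] using
      ((ketBasis α).tsum_inner_mul_inner (A (ket x)) (C (ket x))).symm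
  have h2 : ∀ y, inner ℂ ((C†) (ket y)) ((A†) (ket y)) =
      ∑' x, inner ℂ (A (ket x)) (ket y) * inner ℂ (ket y) (C (ket x)) := fun y => by
    rw [← (ketBasis α).tsum_inner_mul_inner]
    refine tsum_congr fun x => ?_
    rw [ketBasis_apply, ContinuousLinearMap.adjoint_inner_left,
      ContinuousLinearMap.adjoint_inner_right, mul_comm]
  have h3 : Summable (Function.uncurry fun x y =>
      inner ℂ (A (ket x)) (ket y) * inner ℂ (ket y) (C (ket x))) := summable_inner_inner hA hC
  -- Both traces are now iterated sums of one absolutely summable double family.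
  rw [tsum_congr h1, tsum_congr h2]
  exact h3.tsum_comm.symm

/-! ### Expectations of predicates -/

/-- The expectation `tr (P ρ)` of positive operators, as an extended nonnegative real. -/
def expect (P ρ : Op α) : ℝ≥0∞ := ∑' x, quadForm ρ (root P (ket x))

theorem expect_eq_hs_root {P ρ : Op α} (hρ : 0 ≤ ρ) : expect P ρ = hs (root ρ ∘L root P) := by
  exact tsum_congr fun x => quadForm_eq_root hρ _

/-- √ρ√P and √P√ρ are adjoint, hence have equal Hilbert–Schmidt norm. Additivity and monotonicity in
the predicate are read off this form. -/
theorem expect_eq_tsum_root {P ρ : Op α} (hP : 0 ≤ P) (hρ : 0 ≤ ρ) :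
    expect P ρ = ∑' x, quadForm P (root ρ (ket x)) := by
  rw [← expect, expect_eq_hs_root hρ, expect_eq_hs_root hP, ← hs_adjoint,
    ContinuousLinearMap.adjoint_comp, root_adjoint, root_adjoint]

/-- `tr (A† P A ρ) = tr (P A ρ A†)`. -/
theorem expect_conj {P ρ : Op α} (hP : 0 ≤ P) (hρ : 0 ≤ ρ) (A : Op α) :
    expect P (A ∘L ρ ∘L A†) = expect (A† ∘L P ∘L A) ρ := by
  rw [expect_eq_tsum_root (conj_nonneg' hP A) hρ, expect]
  have h1 : ∀ v, quadForm (A ∘L ρ ∘L A†) v = quadForm ρ ((A†) v) := fun v => by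
    simpa using quadForm_conj ρ (A†) v
  simp_rw [h1, quadForm_conj, quadForm_eq_root hP, quadForm_eq_root hρ]
  -- The two sides are the Hilbert–Schmidt norms of √P A √ρ and of its adjoint.
  have := hs_adjoint (root P ∘L A ∘L root ρ)
  simpa [ContinuousLinearMap.adjoint_comp, root_adjoint, hs] using this

theorem expect_one {ρ : Op α} (hρ : 0 ≤ ρ) : expect 1 ρ = hs (root ρ) := by
  rw [expect_eq_tsum_root zero_le_one hρ]
  refine tsum_congr fun x => ?_
  have := quadForm_adjoint_comp (1 : Op α) (root ρ (ket x))
  have e : (1 : Op α)† ∘L (1 : Op α) = (1 : Op α) := by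
    rw [show (1 : Op α)† = 1 from star_one _]
    rfl
  rw [e] at this
  simpa using this

theorem expect_mono {P P' ρ : Op α} (hP : 0 ≤ P) (h : P ≤ P') (hρ : 0 ≤ ρ) :
    expect P ρ ≤ expect P' ρ := by
  rw [expect_eq_tsum_root hP hρ, expect_eq_tsum_root (hP.trans h) hρ]
  exact ENNReal.tsum_le_tsum fun x => quadForm_mono h _

theorem expect_add {P P' ρ : Op α} (hP : 0 ≤ P) (hP' : 0 ≤ P') (hρ : 0 ≤ ρ) :
    expect (P + P') ρ = expect P ρ + expect P' ρ := by
  rw [expect_eq_tsum_root hP hρ, expect_eq_tsum_root hP' hρ,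
    expect_eq_tsum_root (add_nonneg hP hP') hρ, ← ENNReal.tsum_add]
  simp only [quadForm_add hP hP']

/-- Strong convergence suffices because the predicate is only evaluated at the vectors √ρ|x⟩;
Tonelli does the rest. -/
theorem expect_hasStrongSum {ι : Type*} {f : ι → Op α} {P ρ : Op α} (hf : ∀ i, 0 ≤ f i)
    (hP : 0 ≤ P) (h : ∀ v, HasSum (fun i => f i v) (P v)) (hρ : 0 ≤ ρ) :
    expect P ρ = ∑' i, expect (f i) ρ := by
  simp_rw [fun i => expect_eq_tsum_root (hf i) hρ, expect_eq_tsum_root hP hρ]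
  rw [ENNReal.tsum_comm]
  exact tsum_congr fun x => quadForm_hasSum hf (h _)

theorem expect_tsum {ι : Type*} {f : ι → Op α} (P : Op α) (hf : ∀ i, 0 ≤ f i)
    (h : Summable f) : expect P (∑' i, f i) = ∑' i, expect P (f i) := by
  simp_rw [expect]
  rw [ENNReal.tsum_comm]
  exact tsum_congr fun x => quadForm_hasSum hf
    ((ContinuousLinearMap.apply ℂ (L2 α) (root P (ket x))).hasSum h.hasSum)

/-- ‖ρ‖ ≤ ‖√ρ‖², and the operator norm is at most the Hilbert–Schmidt norm. This turns trace bounds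
into norm summability. -/
theorem enorm_le_expect_one {ρ : Op α} (hρ : 0 ≤ ρ) : ‖ρ‖ₑ ≤ expect 1 ρ := by
  rw [expect_one hρ]
  refine le_trans ?_ (enorm_sq_le_hs _)
  conv_lhs => rw [← root_comp_root hρ]
  rw [sq]
  simp only [← ofReal_norm]
  rw [← ENNReal.ofReal_mul (norm_nonneg _)]
  exact ENNReal.ofReal_le_ofReal (ContinuousLinearMap.opNorm_comp_le _ _)

theorem summable_of_expect {ι : Type*} {f : ι → Op α} (hf : ∀ i, 0 ≤ f i)
    (h : ∑' i, expect 1 (f i) ≠ ∞) : Summable f :=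
  Summable.of_enorm (ne_top_of_le_ne_top h
    (ENNReal.tsum_le_tsum fun i => enorm_le_expect_one (hf i)))

theorem tsum_op_nonneg {ι : Type*} {f : ι → Op α} (hf : ∀ i, 0 ≤ f i) : 0 ≤ ∑' i, f i := by
  by_cases h : Summable f
  · refine nonneg_of_re_inner fun v => ?_
    have h1 := (innerSL ℂ v).hasSum
      ((ContinuousLinearMap.apply ℂ (L2 α) v).hasSum h.hasSum)
    refine h1.nonneg fun i => ?_
    have := ((ContinuousLinearMap.nonneg_iff_isPositive (f i)).1 (hf i)).inner_nonneg_right v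
    simpa using this
  -- A divergent sum has the default value `0`, so positivity needs no convergence.
  · rw [tsum_eq_zero_of_not_summable h]

/-- P ρ need not be positive, so its diagonal is not termwise comparable with `expect`. Splitting ρ
as √ρ√ρ and cycling one factor gives √ρP√ρ, whose diagonal is nonnegative. -/
theorem re_tr_comp {P ρ : Op α} (hP : 0 ≤ P) (hρ : 0 ≤ ρ) (h : expect 1 ρ ≠ ∞) :
    (tr (P ∘L ρ)).re = (expect P ρ).toReal := by
  rw [expect_one hρ] at h
  have h1 : hs (root ρ ∘L P) ≠ ∞ := by
    rw [← hs_adjoint, ContinuousLinearMap.adjoint_comp, root_adjoint]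
    exact ne_top_of_le_ne_top (ENNReal.mul_ne_top (by simp) h) (hs_comp_le _ _)
  have hPa : P† = P := (IsSelfAdjoint.of_nonneg hP).star_eq
  have h2 : tr (P ∘L ρ) = ∑' y, inner ℂ (root ρ (ket y)) (P (root ρ (ket y))) := by
    have := tsum_inner_adjoint h1 h
    rw [ContinuousLinearMap.adjoint_comp, root_adjoint, hPa] at this
    refine Eq.trans (tsum_congr fun x => ?_) this
    conv_lhs => rw [← root_comp_root hρ]
    simp only [ContinuousLinearMap.comp_apply]
    rw [← P.adjoint_inner_left, hPa, ← (root ρ).adjoint_inner_left, root_adjoint]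
  have h3 : Summable fun y => inner ℂ (root ρ (ket y)) (P (root ρ (ket y))) := by
    refine Summable.of_norm_bounded ((summable_norm_sq_of_hs h).mul_left ‖P‖) fun y => ?_
    refine (norm_inner_le_norm _ _).trans ?_
    nlinarith [P.le_opNorm (root ρ (ket y)), norm_nonneg (root ρ (ket y))]
  rw [h2, Complex.re_tsum h3, expect_eq_tsum_root hP hρ, ENNReal.tsum_toReal_eq]
  · exact tsum_congr fun y => (ENNReal.toReal_ofReal (re_inner_nonneg hP _)).symm
  · exact fun y => ENNReal.ofReal_ne_top

/-- For positive ρ the diagonal sum in any basis is the squared Hilbert–Schmidt norm of √ρ, so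
summability in one basis gives it in all. -/
theorem isPartialDensity_iff {ρ : Op α} : IsPartialDensity ρ ↔ 0 ≤ ρ ∧ expect 1 ρ ≤ 1 := by
  rw [IsPartialDensity, ← ContinuousLinearMap.nonneg_iff_isPositive]
  refine and_congr_right fun hρ => ?_
  have hc : ∀ v, (((inner ℂ v (ρ v)).re : ℝ) : ℂ) = inner ℂ v (ρ v) := fun v => by
    have := ((ContinuousLinearMap.nonneg_iff_isPositive ρ).1 hρ).inner_nonneg_right v
    rw [Complex.le_def] at this
    apply Complex.ext
    · simp
    · simpa using this.2
  have hb : ∀ {ι : Type} (b : HilbertBasis ι ℂ (L2 α)),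
      ∑' i, quadForm ρ (b i) = expect 1 ρ := fun {ι} b => by
    rw [expect_one hρ, hs_eq_tsum_adjoint b, root_adjoint]
    exact tsum_congr fun i => quadForm_eq_root hρ _
  have htr : expect 1 ρ ≠ ∞ → (tr ρ).re = (expect 1 ρ).toReal := fun h => by
    rw [← re_tr_comp zero_le_one hρ h]
    rfl
  have hsum : ∀ {ι : Type} (b : HilbertBasis ι ℂ (L2 α)),
      (Summable fun i => inner ℂ (b i) (ρ (b i))) ↔ expect 1 ρ ≠ ∞ := fun {ι} b => by
    rw [← hb b]
    constructor
    · intro h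
      have h1 := Complex.reCLM.summable h
      have h2 := ENNReal.ofReal_tsum_of_nonneg (fun i => re_inner_nonneg hρ (b i)) h1
      rw [show ∑' i, quadForm ρ (b i) = _ from h2.symm]
      exact ENNReal.ofReal_ne_top
    · intro h
      refine (Complex.ofRealCLM.summable (ENNReal.summable_toReal h)).congr fun i => ?_
      rw [quadForm, ENNReal.toReal_ofReal (re_inner_nonneg hρ _)]
      exact hc _
  constructor
  · rintro ⟨h1, h2⟩
    -- Finiteness must come first: a divergent `tr` would be `0` and would satisfy the bound
    -- vacuously.
    have h3 := (hsum (ketBasis α)).1 (h1 α (ketBasis α))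
    rw [htr h3] at h2
    rw [← ENNReal.ofReal_toReal h3]
    exact ENNReal.ofReal_le_one.2 h2
  · intro h
    have h3 := ne_top_of_le_ne_top ENNReal.one_ne_top h
    refine ⟨fun ι b => (hsum b).2 h3, ?_⟩
    rw [htr h3]
    exact ENNReal.toReal_le_of_le_ofReal zero_le_one (by simpa using h)


/-! ### Kraus families and cylinder extensions -/

/-- A family of operators with `∑ i, A_i† A_i = 1`. -/
def IsKraus {α ι : Type} (A : ι → Op α) : Prop := ∀ ψ, ∑' i, ‖A i ψ‖ₑ ^ 2 = ‖ψ‖ₑ ^ 2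

theorem Measurement.isKraus {α O : Type} (M : Measurement α O) : IsKraus M.op := fun ψ => by
  have h1 : ∀ K : Op α, 0 ≤ K† ∘L K := fun K => by
    exact conj_nonneg' (zero_le_one (α := Op α)) K
  have h := quadForm_hasSum (fun m => h1 (M.op m)) (M.complete ψ)
  simp only [quadForm_adjoint_comp] at h
  rw [← h, quadForm, ← ofReal_norm_sq]
  simp only [one_apply_eq_self, inner_self_eq_norm_sq_to_K]
  norm_cast

theorem isKraus_of_isometry {α : Type} {U : Op α} (hU : U† ∘L U = 1) :
    IsKraus fun _ : Unit => U := fun ψ => by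
  rw [tsum_fintype, Finset.univ_unique, Finset.sum_singleton, ← quadForm_adjoint_comp, hU,
    quadForm, ← ofReal_norm_sq]
  simp only [one_apply_eq_self, inner_self_eq_norm_sq_to_K]
  norm_cast

theorem ketBra_apply {α : Type} (x y : α) (ψ : L2 α) :
    ketBra x y ψ = inner ℂ (ket y) ψ • ket x := rfl

theorem isKraus_ketBra {α : Type} (z : α) : IsKraus fun x => ketBra z x := fun ψ => by
  have h1 : ‖ket z‖ₑ = 1 := by
    rw [← ofReal_norm, ← ketBasis_apply, (ketBasis α).orthonormal.1 z, ENNReal.ofReal_one]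
  simp only [ketBra_apply, enorm_smul, h1, mul_one]
  simpa only [ketBasis_apply] using parseval (ketBasis α) ψ

theorem ketBra_adjoint {α : Type} (x y : α) : (ketBra x y)† = ketBra y x := by
  refine ((ContinuousLinearMap.eq_adjoint_iff _ _).2 fun v w => ?_).symm
  rw [ketBra_apply, ketBra_apply, inner_smul_left, inner_smul_right, inner_conj_symm, mul_comm]

section Extend

variable {κ α δ : Type} (e : κ ≃ α × δ)

theorem slice_extend (A : Op α) (d : δ) (ψ : L2 κ) :
    slice e d (extend e A ψ) = A (slice e d ψ) := by
  ext x
  change A (slice e (e (e.symm (x, d))).2 ψ) (e (e.symm (x, d))).1 = _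
  simp

theorem tsum_enorm_slice (ψ : L2 κ) : ∑' d, ‖slice e d ψ‖ₑ ^ 2 = ‖ψ‖ₑ ^ 2 := by
  have h := hasSum_slice e ψ
  simp only [← ofReal_norm_sq]
  rw [← h.tsum_eq, ENNReal.ofReal_tsum_of_nonneg (fun d => by positivity) h.summable]

theorem hasSum_inner_slice (ψ φ : L2 κ) :
    HasSum (fun d => inner ℂ (slice e d ψ) (slice e d φ)) (inner ℂ ψ φ) := by
  have h := lp.hasSum_inner (𝕜 := ℂ) ψ φ
  rw [← ((Equiv.prodComm δ α).trans e.symm).hasSum_iff] at h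
  exact h.prod_fiberwise fun d => lp.hasSum_inner (𝕜 := ℂ) (slice e d ψ) (slice e d φ)

theorem extend_adjoint (A : Op α) : (extend e A)† = extend e (A†) := by
  refine ((ContinuousLinearMap.eq_adjoint_iff _ _).2 fun ψ φ => ?_).symm
  refine (hasSum_inner_slice e _ _).unique ?_
  have h := hasSum_inner_slice e ψ (extend e A φ)
  simpa only [slice_extend, ContinuousLinearMap.adjoint_inner_left] using h

/-- A ⊗ 1 acts separately on each slice, and squared norms add up over slices. -/
theorem IsKraus.extend {ι : Type} {A : ι → Op α} (h : IsKraus A) :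
    IsKraus fun i => extend e (A i) := fun ψ => by
  simp_rw [← tsum_enorm_slice e, slice_extend]
  rw [ENNReal.tsum_comm]
  exact tsum_congr fun d => h _

end Extend

theorem tsum_expect_one_conj {α ι : Type} {A : ι → Op α} (h : IsKraus A) {ρ : Op α}
    (hρ : 0 ≤ ρ) : ∑' i, expect 1 (A i ∘L ρ ∘L (A i)†) = expect 1 ρ := by
  have h1 : ∀ i, expect 1 (A i ∘L ρ ∘L (A i)†) = ∑' x, ‖A i (root ρ (ket x))‖ₑ ^ 2 := fun i => by
    rw [expect_conj zero_le_one hρ, expect_eq_tsum_root (conj_nonneg' zero_le_one _) hρ]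
    exact tsum_congr fun x => quadForm_adjoint_comp (A i) _
  simp_rw [h1]
  rw [ENNReal.tsum_comm, expect_one hρ]
  exact tsum_congr fun x => h _

variable {Var : Type} {ty : Var → QType} (B : ProductBasis ty)

theorem isKraus_measurement (r : Register Var) {O : Type} (M : Measurement (r.Idx ty) O) :
    IsKraus fun m => cyl B r (M.op m) := M.isKraus.extend _

theorem isKraus_ketBraAt (q : Var) (z : (Register.single q).Idx ty) :
    IsKraus fun x => ketBraAt B q z x := (isKraus_ketBra z).extend _

theorem ketBraAt_adjoint (q : Var) (x y : (Register.single q).Idx ty) :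
    (ketBraAt B q x y)† = ketBraAt B q y x := by
  rw [ketBraAt, cyl, extend_adjoint, ketBra_adjoint]
  rfl

/-! ### Finite positive operators -/

/-- Positive operators of finite trace. -/
def IsFiniteState {α : Type} (ρ : Op α) : Prop := 0 ≤ ρ ∧ expect 1 ρ ≠ ∞

theorem initState_eq (q : Var) (ρ : Op B.Idx) :
    initState B q ρ = ∑' x, ketBraAt B q (Register.zero _ ty) x ∘L ρ ∘L
      (ketBraAt B q (Register.zero _ ty) x)† := by
  simp only [ketBraAt_adjoint]
  rfl

variable {B}

theorem expect_initState (q : Var) {ρ P : Op B.Idx} (hρ : IsFiniteState ρ) :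
    expect P (initState B q ρ) = ∑' x, expect P (ketBraAt B q (Register.zero _ ty) x ∘L ρ ∘L
      (ketBraAt B q (Register.zero _ ty) x)†) := by
  rw [initState_eq]
  refine expect_tsum P (fun x => conj_nonneg hρ.1 _) ?_
  refine summable_of_expect (fun x => conj_nonneg hρ.1 _) ?_
  rw [tsum_expect_one_conj (isKraus_ketBraAt B q _) hρ.1]
  exact hρ.2

/-- `E` has a Kraus representation on positive operators of finite trace, phrased in terms of
expectations. -/
def HasKrausForm (E : Op B.Idx → Op B.Idx) : Prop :=
  ∃ (κ : Type) (D : κ → Op B.Idx), ∀ ρ, IsFiniteState ρ → ∀ P, 0 ≤ P →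
    expect P (E ρ) = ∑' k, expect ((D k)† ∘L P ∘L D k) ρ

theorem hasKrausForm_conj (A : Op B.Idx) : HasKrausForm fun ρ => A ∘L ρ ∘L A† :=
  ⟨Unit, fun _ => A, fun ρ hρ P hP => by
    rw [tsum_fintype, Finset.univ_unique, Finset.sum_singleton, expect_conj hP hρ.1]⟩

theorem hasKrausForm_id : HasKrausForm fun ρ : Op B.Idx => ρ := by
  have h := hasKrausForm_conj (1 : Op B.Idx)
  have e : (1 : Op B.Idx)† = 1 := star_one _
  rw [e] at h
  exact h

theorem HasKrausForm.comp {E F : Op B.Idx → Op B.Idx} (hF : HasKrausForm F) (hE : HasKrausForm E)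
    (h : ∀ ρ, IsFiniteState ρ → IsFiniteState (E ρ)) : HasKrausForm fun ρ => F (E ρ) := by
  obtain ⟨κ, D, hD⟩ := hE
  obtain ⟨κ', D', hD'⟩ := hF
  refine ⟨κ' × κ, fun k => D' k.1 ∘L D k.2, fun ρ hρ P hP => ?_⟩
  rw [hD' _ (h ρ hρ) P hP, ENNReal.tsum_prod
    (f := fun k' k => expect ((D' k' ∘L D k)† ∘L P ∘L D' k' ∘L D k) ρ)]
  refine tsum_congr fun k' => ?_
  rw [hD ρ hρ _ (conj_nonneg' hP _)]
  refine tsum_congr fun k => ?_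
  rw [ContinuousLinearMap.adjoint_comp]
  rfl

/-- `ρ` is the sum of the family `f`, phrased in terms of expectations. -/
def IsMixture {ι : Type*} (ρ : Op B.Idx) (f : ι → Op B.Idx) : Prop :=
  ∀ P, 0 ≤ P → expect P ρ = ∑' i, expect P (f i)

/-- The Kraus form transfers `E` to the predicate, where the mixture hypothesis applies to each
D†PD. These are merely positive, hence the quantification over all positive P. -/
theorem HasKrausForm.isMixture {E : Op B.Idx → Op B.Idx} (hE : HasKrausForm E) {ι : Type*}
    {ρ : Op B.Idx} {f : ι → Op B.Idx} (h : IsMixture ρ f) (hρ : IsFiniteState ρ)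
    (hf : ∀ i, IsFiniteState (f i)) : IsMixture (E ρ) fun i => E (f i) := fun P hP => by
  obtain ⟨κ, D, hD⟩ := hE
  simp_rw [hD ρ hρ P hP, fun i => hD (f i) (hf i) P hP, fun k => h _ (conj_nonneg' hP (D k))]
  exact ENNReal.tsum_comm

/-! ### Deterministic presentation of the transitions -/

/-- The labels of the transitions of a program. -/
def Outcome : Prog ty → Type
  | .skip => Unit
  | .init _ => Unit
  | .unitary _ _ _ => Unit
  | .seq S₁ _ => Outcome S₁
  | .measure (O := O) _ _ _ => O
  | .loop _ _ _ => Fin 2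

/-- The program that remains after a transition. -/
def next : (S : Prog ty) → Outcome S → Option (Prog ty)
  | .skip, _ => none
  | .init _, _ => none
  | .unitary _ _ _, _ => none
  | .seq S₁ S₂, i => some (Prog.andThen (next S₁ i) S₂)
  | .measure _ _ S, m => some (S m)
  | .loop r M S, i => if (show Fin 2 from i) = 0 then none else some (.seq S (.loop r M S))

variable (B) in
/-- The effect of a transition on the state. -/
def act : (S : Prog ty) → Outcome S → Op B.Idx → Op B.Idx
  | .skip, _ => fun ρ => ρ
  | .init q, _ => initState B q
  | .unitary r U _, _ => fun ρ => cyl B r U ∘L ρ ∘L (cyl B r U)†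
  | .seq S₁ _, i => act S₁ i
  | .measure r M _, m => fun ρ => cyl B r (M.op m) ∘L ρ ∘L (cyl B r (M.op m))†
  | .loop r M _, i => fun ρ => cyl B r (M.op i) ∘L ρ ∘L (cyl B r (M.op i))†

theorem act_nonneg : ∀ (S : Prog ty) (i : Outcome S) {ρ : Op B.Idx}, 0 ≤ ρ → 0 ≤ act B S i ρ
  | .skip, _, _, h => h
  | .init q, _, ρ, h => by
    change 0 ≤ initState B q ρ
    rw [initState_eq]
    exact tsum_op_nonneg fun x => conj_nonneg h _
  | .unitary _ _ _, _, _, h => conj_nonneg h _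
  | .seq S₁ _, i, _, h => act_nonneg S₁ i h
  | .measure _ _ _, _, _, h => conj_nonneg h _
  | .loop _ _ _, _, _, h => conj_nonneg h _

theorem tsum_unit (f : Unit → ℝ≥0∞) : ∑' i, f i = f () := by
  rw [tsum_fintype, Finset.univ_unique, Finset.sum_singleton]

theorem tsum_expect_one_act : ∀ (S : Prog ty) {ρ : Op B.Idx}, IsFiniteState ρ →
    ∑' i, expect 1 (act B S i ρ) = expect 1 ρ
  | .skip, ρ, _ => tsum_unit fun _ => expect 1 ρ
  | .init q, ρ, h => by
    refine (tsum_unit fun _ => expect 1 (initState B q ρ)).trans ?_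
    rw [expect_initState q h, tsum_expect_one_conj (isKraus_ketBraAt B q _) h.1]
  | .unitary r U hU, _, h =>
    tsum_expect_one_conj ((isKraus_of_isometry hU).extend (B.split r)) h.1
  | .seq S₁ _, _, h => tsum_expect_one_act S₁ h
  | .measure r M _, _, h => tsum_expect_one_conj (isKraus_measurement B r M) h.1
  | .loop r M _, _, h => tsum_expect_one_conj (isKraus_measurement B r M) h.1

theorem isFiniteState_act (S : Prog ty) (i : Outcome S) {ρ : Op B.Idx} (h : IsFiniteState ρ) :
    IsFiniteState (act B S i ρ) := by
  refine ⟨act_nonneg S i h.1, ne_top_of_le_ne_top h.2 ?_⟩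
  rw [← tsum_expect_one_act S h]
  exact ENNReal.le_tsum i

theorem hasKrausForm_act : ∀ (S : Prog ty) (i : Outcome S), HasKrausForm (act B S i)
  | .skip, _ => hasKrausForm_id
  | .init q, _ => ⟨_, fun x => ketBraAt B q (Register.zero _ ty) x, fun ρ hρ P hP => by
      change expect P (initState B q ρ) = _
      rw [expect_initState q hρ]
      exact tsum_congr fun x => expect_conj hP hρ.1 _⟩
  | .unitary _ _ _, _ => hasKrausForm_conj _
  | .seq S₁ _, i => hasKrausForm_act S₁ i
  | .measure _ _ _, _ => hasKrausForm_conj _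
  | .loop _ _ _, _ => hasKrausForm_conj _

variable (B) in
/-- The transition with a given label. -/
def stepOf : (S : Prog ty) → (i : Outcome S) → (ρ : Op B.Idx) →
    Step B S ρ (next S i) (act B S i ρ)
  | .skip, _, ρ => .skip ρ
  | .init q, _, ρ => .init q ρ
  | .unitary r U hU, _, ρ => .unitary r U hU ρ
  | .seq S₁ S₂, i, ρ => .seq S₂ (stepOf S₁ i ρ)
  | .measure r M S, m, ρ => .measure r M S ρ m
  | .loop r M S, ⟨0, _⟩, ρ => .loop0 r M S ρ
  | .loop r M S, ⟨1, _⟩, ρ => .loop1 r M S ρ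

/-- The label of a transition. -/
def Step.label : {S : Prog ty} → {ρ : Op B.Idx} → {S' : Option (Prog ty)} → {ρ' : Op B.Idx} →
    Step B S ρ S' ρ' → Outcome S
  | _, _, _, _, .skip _ => ()
  | _, _, _, _, .init _ _ => ()
  | _, _, _, _, .unitary _ _ _ _ => ()
  | _, _, _, _, .seq _ h => h.label
  | _, _, _, _, .measure _ _ _ _ m => m
  | _, _, _, _, .loop0 _ _ _ _ => (0 : Fin 2)
  | _, _, _, _, .loop1 _ _ _ _ => (1 : Fin 2)

theorem label_stepOf : ∀ (S : Prog ty) (i : Outcome S) (ρ : Op B.Idx), (stepOf B S i ρ).label = i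
  | .skip, _, _ => rfl
  | .init _, _, _ => rfl
  | .unitary _ _ _, _, _ => rfl
  | .seq S₁ _, i, ρ => label_stepOf S₁ i ρ
  | .measure _ _ _, _, _ => rfl
  | .loop _ _ _, ⟨0, _⟩, _ => rfl
  | .loop _ _ _, ⟨1, _⟩, _ => rfl

/-- A transition out of the configuration `⟨S, ρ⟩`. -/
abbrev AnyStep (S : Prog ty) (ρ : Op B.Idx) : Type 1 :=
  Σ (S' : Option (Prog ty)) (ρ' : Op B.Idx), Step B S ρ S' ρ'

/-- With `label_stepOf`, this makes labels and transitions inverse to each other. Packing the target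
configuration into the sigma type avoids heterogeneous equality. -/
theorem stepOf_label {S : Prog ty} {ρ : Op B.Idx} {S' : Option (Prog ty)} {ρ' : Op B.Idx}
    (h : Step B S ρ S' ρ') :
    (⟨_, _, stepOf B S h.label ρ⟩ : AnyStep S ρ) = ⟨S', ρ', h⟩ := by
  induction h with
  | skip ρ => rfl
  | init q ρ => rfl
  | unitary r U hU ρ => rfl
  | seq S₂ h ih =>
    exact congrArg (fun s : AnyStep _ _ => (⟨_, _, .seq S₂ s.2.2⟩ : AnyStep _ _)) ih
  | measure r M S ρ m => rfl
  | loop0 r M S ρ => rfl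
  | loop1 r M S ρ => rfl

/-! ### Computation paths -/

/-- The label sequences of terminating computations. -/
inductive Path : Option (Prog ty) → Type 1 where
  | nil : Path none
  | cons {S : Prog ty} (i : Outcome S) (p : Path (next S i)) : Path (some S)

/-- The effect of a computation path on the state. -/
def Path.run : {c : Option (Prog ty)} → Path c → Op B.Idx → Op B.Idx
  | _, .nil => fun ρ => ρ
  | _, .cons (S := S) i p => fun ρ => p.run (act B S i ρ)

/-- The number of transitions of a path. -/
def Path.length : {c : Option (Prog ty)} → Path c → ℕ
  | _, .nil => 0
  | _, .cons _ p => p.length + 1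

theorem isFiniteState_run {c : Option (Prog ty)} (p : Path c) {ρ : Op B.Idx}
    (h : IsFiniteState ρ) : IsFiniteState (p.run ρ) := by
  induction p generalizing ρ with
  | nil => exact h
  | cons i p ih => exact ih (isFiniteState_act _ i h)

theorem hasKrausForm_run {c : Option (Prog ty)} (p : Path c) :
    HasKrausForm (B := B) fun ρ => p.run ρ := by
  induction p with
  | nil => exact hasKrausForm_id
  | cons i p ih =>
    exact ih.comp (hasKrausForm_act _ i) fun ρ hρ => isFiniteState_act _ i hρ

/-- Paths of a nonempty program are transitions followed by paths. -/
def Path.consEquiv (S : Prog ty) : (Σ i : Outcome S, Path (next S i)) ≃ Path (some S) where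
  toFun x := .cons x.1 x.2
  invFun
    | .cons i p => ⟨i, p⟩
  left_inv _ := rfl
  right_inv
    | .cons _ _ => rfl

/-- `nil` is the only path of the empty program. -/
def Path.nilEquiv : Unit ≃ Path (none : Option (Prog ty)) where
  toFun _ := .nil
  invFun _ := ()
  left_inv _ := rfl
  right_inv
    | .nil => rfl

/-- The cutoff supplies an induction where loops do not terminate. Trace still running after `n`
steps is lost, hence only an inequality. -/
theorem tsum_expect_one_run_length_le (n : ℕ) (c : Option (Prog ty)) {ρ : Op B.Idx}
    (h : IsFiniteState ρ) :
    ∑' p : Path c, (if p.length ≤ n then expect 1 (p.run ρ) else 0) ≤ expect 1 ρ := by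
  induction n generalizing c ρ with
  | zero =>
    cases c with
    | none =>
      rw [← Path.nilEquiv.tsum_eq, tsum_unit]
      exact le_rfl
    | some S =>
      rw [← (Path.consEquiv S).tsum_eq]
      simp [Path.consEquiv, Path.length]
  | succ n ih =>
    cases c with
    | none =>
      rw [← Path.nilEquiv.tsum_eq, tsum_unit]
      simp [Path.nilEquiv, Path.length, Path.run]
    | some S =>
      rw [← (Path.consEquiv S).tsum_eq, ENNReal.tsum_sigma', ← tsum_expect_one_act S h]
      refine ENNReal.tsum_le_tsum fun i => le_trans (le_of_eq ?_) (ih (next S i)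
        (isFiniteState_act S i h))
      simp [Path.consEquiv, Path.length, Path.run]

theorem tsum_expect_one_run_le (c : Option (Prog ty)) {ρ : Op B.Idx} (h : IsFiniteState ρ) :
    ∑' p : Path c, expect 1 (p.run ρ) ≤ expect 1 ρ := by
  rw [ENNReal.tsum_eq_iSup_sum]
  refine iSup_le fun s => ?_
  -- Finitely many paths have a common length bound.
  refine le_trans ?_ (tsum_expect_one_run_length_le (s.sup Path.length) c h)
  refine le_trans (Finset.sum_le_sum fun p hp => ?_) (ENNReal.sum_le_tsum s)
  rw [if_pos (Finset.le_sup hp)]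

variable (B) in
/-- The computation that follows a path. -/
def Path.steps : {c : Option (Prog ty)} → (p : Path c) → (ρ : Op B.Idx) →
    Steps B c ρ none (p.run ρ)
  | _, .nil, ρ => .refl _ ρ
  | _, .cons i p, ρ => .head (stepOf B _ i ρ) (p.steps _)

/-- The terminating computations out of a configuration. -/
abbrev Computation (c : Option (Prog ty)) (ρ : Op B.Idx) : Type 1 :=
  Σ ρ' : Op B.Idx, Steps B c ρ none ρ'

/-- The first transition of a computation and the remaining computation. -/
def Computation.uncons {S : Prog ty} {ρ : Op B.Idx} :
    Computation (some S) ρ → Σ s : AnyStep S ρ, Computation s.1 s.2.1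
  | ⟨_, .head h t⟩ => ⟨⟨_, _, h⟩, ⟨_, t⟩⟩

variable (B) in
/-- The computation that follows a path, with its final state. -/
def Path.computation {c : Option (Prog ty)} (ρ : Op B.Idx) (p : Path c) : Computation c ρ :=
  ⟨_, p.steps B ρ⟩

theorem Path.computation_injective {c : Option (Prog ty)} (ρ : Op B.Idx) :
    Function.Injective (Path.computation B (c := c) ρ) := by
  intro p
  induction p generalizing ρ with
  | nil =>
    rintro ⟨⟩ -
    rfl
  | cons i p ih =>
    intro p' h
    cases p' with
    | cons j p' =>
      have h1 := congrArg Computation.uncons h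
      have h2 : i = j := by
        have := congrArg (fun x => x.1.2.2.label) h1
        exact (label_stepOf _ i ρ).symm.trans (this.trans (label_stepOf _ j ρ))
      subst h2
      have h3 := eq_of_heq (Sigma.mk.inj h1).2
      rw [ih _ h3]

theorem exists_computation_eq {c c' : Option (Prog ty)} {ρ ρ' : Op B.Idx}
    (t : Steps B c ρ c' ρ') (hc : c' = none) :
    ∃ p : Path c, p.computation B ρ = ⟨ρ', hc ▸ t⟩ := by
  induction t with
  | refl S ρ =>
    subst hc
    exact ⟨.nil, rfl⟩
  | head h t ih =>
    obtain ⟨p, hp⟩ := ih hc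
    subst hc
    have h1 := stepOf_label h
    -- The label itself mentions `h`; as a variable it lets `cases` eliminate `h` in favour of
    -- `stepOf`.
    generalize h.label = i at h1
    cases h1
    refine ⟨.cons i p, ?_⟩
    exact congrArg (fun x : Computation _ _ => (⟨x.1, .head _ x.2⟩ : Computation _ _)) hp

theorem Path.computation_surjective {c : Option (Prog ty)} (ρ : Op B.Idx) :
    Function.Surjective (Path.computation B (c := c) ρ) :=
  fun x => exists_computation_eq x.2 rfl

variable (B) in
/-- Paths correspond to terminating computations. -/
def pathEquiv (S : Prog ty) (ρ : Op B.Idx) : Path (some S) ≃ Terminating B S ρ :=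
  Equiv.ofBijective (Path.computation B ρ)
    ⟨Path.computation_injective ρ, Path.computation_surjective ρ⟩

/-! ### Convergence of the semantic function and its trace bound -/

theorem summable_run (S : Prog ty) {ρ : Op B.Idx} (h : IsFiniteState ρ) :
    Summable fun p : Path (some S) => p.run ρ :=
  summable_of_expect (fun p => (isFiniteState_run p h).1)
    (ne_top_of_le_ne_top h.2 (tsum_expect_one_run_le _ h))

theorem summable_terminating (S : Prog ty) {ρ : Op B.Idx} (h : IsFiniteState ρ) :
    Summable fun x : Terminating B S ρ => x.1 :=
  (pathEquiv B S ρ).summable_iff.1 (summable_run S h)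

theorem sem_eq (S : Prog ty) (ρ : Op B.Idx) : sem B S ρ = ∑' p : Path (some S), p.run ρ :=
  ((pathEquiv B S ρ).tsum_eq fun x => x.1).symm

theorem expect_sem (P : Op B.Idx) (S : Prog ty) {ρ : Op B.Idx} (h : IsFiniteState ρ) :
    expect P (sem B S ρ) = ∑' p : Path (some S), expect P (p.run ρ) := by
  rw [sem_eq]
  exact expect_tsum P (fun p => (isFiniteState_run p h).1) (summable_run S h)

theorem sem_nonneg (S : Prog ty) {ρ : Op B.Idx} (h : IsFiniteState ρ) : 0 ≤ sem B S ρ := by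
  rw [sem_eq]
  exact tsum_op_nonneg fun p => (isFiniteState_run p h).1

theorem expect_one_sem_le (S : Prog ty) {ρ : Op B.Idx} (h : IsFiniteState ρ) :
    expect 1 (sem B S ρ) ≤ expect 1 ρ := by
  rw [expect_sem 1 S h]
  exact tsum_expect_one_run_le _ h

theorem isFiniteState_sem (S : Prog ty) {ρ : Op B.Idx} (h : IsFiniteState ρ) :
    IsFiniteState (sem B S ρ) :=
  ⟨sem_nonneg S h, ne_top_of_le_ne_top h.2 (expect_one_sem_le S h)⟩

/-- Expectations after a program are additive in the initial state. -/
theorem expect_sem_sem {P : Op B.Idx} (hP : 0 ≤ P) (S T : Prog ty) {ρ : Op B.Idx}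
    (h : IsFiniteState ρ) : expect P (sem B T (sem B S ρ)) =
      ∑' p : Path (some S), ∑' q : Path (some T), expect P (q.run (p.run ρ)) := by
  rw [expect_sem P T (isFiniteState_sem S h), ENNReal.tsum_comm]
  refine tsum_congr fun q => ?_
  -- For fixed `q`, the Kraus form distributes `q.run` over the sum defining the state after `S`.
  exact (hasKrausForm_run q).isMixture (fun Q _ => expect_sem Q S h) (isFiniteState_sem S h)
    (fun p => isFiniteState_run p h) P hP

/-! ### Sequential composition -/

/-- Concatenation of paths. -/
def Path.append {T : Prog ty} : {c : Option (Prog ty)} → Path c → Path (some T) →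
    Path (some (Prog.andThen c T))
  | _, .nil, q => q
  | _, .cons (S := S) i p, q => .cons (S := .seq S T) i (p.append q)

theorem Path.run_append {T : Prog ty} {c : Option (Prog ty)} (p : Path c) (q : Path (some T))
    (ρ : Op B.Idx) : (p.append q).run ρ = q.run (p.run ρ) := by
  induction p generalizing ρ with
  | nil => rfl
  | cons i p ih => exact ih _

theorem Path.append_injective {T : Prog ty} {c : Option (Prog ty)} {p p' : Path c}
    {q q' : Path (some T)} (h : p.append q = p'.append q') : p = p' ∧ q = q' := by
  induction p with
  | nil =>
    cases p'
    exact ⟨rfl, h⟩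
  | cons i p ih =>
    cases p' with
    | cons j p' =>
      have h1 := (Path.consEquiv _).symm.injective.eq_iff.2 h
      obtain rfl : i = j := congrArg Sigma.fst h1
      obtain ⟨rfl, h3⟩ := ih (eq_of_heq (Sigma.mk.inj h1).2)
      exact ⟨rfl, h3⟩

/-- Concatenation embeds pairs of paths into the paths of the composite. Soundness bounds final
expectations from below, so injectivity is enough. -/
theorem expect_sem_sem_le {P : Op B.Idx} (hP : 0 ≤ P) (S T : Prog ty) {ρ : Op B.Idx}
    (h : IsFiniteState ρ) : expect P (sem B T (sem B S ρ)) ≤ expect P (sem B (.seq S T) ρ) := by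
  rw [expect_sem_sem hP S T h, expect_sem P (.seq S T) h, ← ENNReal.tsum_prod]
  refine le_trans (le_of_eq (tsum_congr fun x => ?_)) (ENNReal.tsum_comp_le_tsum_of_injective
    (f := fun x : Path (some S) × Path (some T) => x.1.append x.2) ?_ _)
  · exact congrArg (expect P) (Path.run_append x.1 x.2 ρ).symm
  · rintro ⟨p, q⟩ ⟨p', q'⟩ hpq
    obtain ⟨rfl, rfl⟩ := Path.append_injective hpq
    rfl

/-- The expectation after all computations of a configuration. -/
def postExpect (P : Op B.Idx) (c : Option (Prog ty)) (ρ : Op B.Idx) : ℝ≥0∞ :=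
  ∑' p : Path c, expect P (p.run ρ)

theorem postExpect_none (P ρ : Op B.Idx) :
    postExpect P (none : Option (Prog ty)) ρ = expect P ρ := by
  rw [postExpect, ← Path.nilEquiv.tsum_eq, tsum_unit]
  rfl

/-- Splitting off the first transition; this unfolds the semantics of every construct except
composition. -/
theorem postExpect_some (P : Op B.Idx) (S : Prog ty) (ρ : Op B.Idx) :
    postExpect P (some S) ρ = ∑' i, postExpect P (next S i) (act B S i ρ) := by
  rw [postExpect, ← (Path.consEquiv S).tsum_eq, ENNReal.tsum_sigma']
  rfl

theorem postExpect_some_eq (P : Op B.Idx) (S : Prog ty) {ρ : Op B.Idx} (h : IsFiniteState ρ) :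
    postExpect P (some S) ρ = expect P (sem B S ρ) := (expect_sem P S h).symm

/-! ### Soundness -/

/-- Total correctness in terms of expectations. -/
def ExpectCorrect (P : Op B.Idx) (S : Prog ty) (Q : Op B.Idx) : Prop :=
  ∀ ρ, IsPartialDensity ρ → expect P ρ ≤ expect Q (sem B S ρ)

theorem IsPartialDensity.isFiniteState {α : Type} {ρ : Op α} (h : IsPartialDensity ρ) :
    IsFiniteState ρ :=
  ⟨(isPartialDensity_iff.1 h).1,
    ne_top_of_le_ne_top ENNReal.one_ne_top (isPartialDensity_iff.1 h).2⟩

theorem isPartialDensity_sem (S : Prog ty) {ρ : Op B.Idx} (h : IsPartialDensity ρ) :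
    IsPartialDensity (sem B S ρ) :=
  isPartialDensity_iff.2 ⟨sem_nonneg S h.isFiniteState,
    (expect_one_sem_le S h.isFiniteState).trans (isPartialDensity_iff.1 h).2⟩

theorem isPartialDensity_act (S : Prog ty) (i : Outcome S) {ρ : Op B.Idx}
    (h : IsPartialDensity ρ) : IsPartialDensity (act B S i ρ) := by
  refine isPartialDensity_iff.2 ⟨act_nonneg S i h.isFiniteState.1,
    le_trans ?_ (isPartialDensity_iff.1 h).2⟩
  rw [← tsum_expect_one_act S h.isFiniteState]
  exact ENNReal.le_tsum i

theorem ExpectCorrect.totallyCorrect {P Q : Predicate B} {S : Prog ty}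
    (h : ExpectCorrect P.1 S Q.1) : TotallyCorrect P S Q := by
  rintro ⟨ρ, hρ⟩
  have h1 := hρ.isFiniteState
  have h2 := isFiniteState_sem S h1
  refine ⟨summable_terminating S h1, isPartialDensity_sem S hρ, ?_⟩
  rw [re_tr_comp P.2.1 h1.1 h1.2, re_tr_comp Q.2.1 h2.1 h2.2]
  -- `toReal` sends `∞` to `0`, so the right side must be finite; it is, since Q ⊑ I.
  refine ENNReal.toReal_mono (ne_top_of_le_ne_top h2.2 ?_) (h ρ hρ)
  exact expect_mono Q.2.1 Q.2.2 h2.1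

theorem expectCorrect_loop (r : Register Var) (M : Measurement (r.Idx ty) (Fin 2)) (S : Prog ty)
    {P Q R : Op B.Idx} (hP : 0 ≤ P) (hQ : 0 ≤ Q) (hQ1 : Q ≤ 1)
    (hR : R = (cyl B r (M.op 0))† ∘L P ∘L cyl B r (M.op 0) +
      (cyl B r (M.op 1))† ∘L Q ∘L cyl B r (M.op 1))
    (h : ExpectCorrect Q S R)
    (ht : ∀ ε : ℝ, 0 < ε → ∃ t : PartialDensity B → ℕ,
      IsBoundFunction r M S ((cyl B r (M.op 1))† ∘L Q ∘L cyl B r (M.op 1)) ε t) :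
    ExpectCorrect R (.loop r M S) P := by
  set A := cyl B r (M.op 0)
  set C := cyl B r (M.op 1)
  have hA : ∀ {ρ : Op B.Idx}, IsPartialDensity ρ → IsPartialDensity (A ∘L ρ ∘L A†) :=
    fun hρ => isPartialDensity_act (.loop r M S) (0 : Fin 2) hρ
  have hC : ∀ {ρ : Op B.Idx}, IsPartialDensity ρ → IsPartialDensity (C ∘L ρ ∘L C†) :=
    fun hρ => isPartialDensity_act (.loop r M S) (1 : Fin 2) hρ
  have hRρ : ∀ {ρ : Op B.Idx}, IsPartialDensity ρ →
      expect R ρ = expect P (A ∘L ρ ∘L A†) + expect Q (C ∘L ρ ∘L C†) := fun {ρ} hρ => by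
    have hρ0 := hρ.isFiniteState.1
    rw [hR, expect_add (conj_nonneg' hP A) (conj_nonneg' hQ C) hρ0, expect_conj hP hρ0,
      expect_conj hQ hρ0]
  -- One unfolding of the loop: exit at once, or run the body and then the loop again.
  have hL : ∀ {ρ : Op B.Idx}, IsPartialDensity ρ →
      expect P (A ∘L ρ ∘L A†) + expect P (sem B (.loop r M S) (sem B S (C ∘L ρ ∘L C†))) ≤
        expect P (sem B (.loop r M S) ρ) := fun {ρ} hρ => by
    rw [← postExpect_some_eq P (.loop r M S) hρ.isFiniteState, postExpect_some]
    change _ ≤ ∑' i : Fin 2, _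
    rw [tsum_fintype, Fin.sum_univ_two]
    refine add_le_add (le_of_eq ?_) ?_
    · exact (postExpect_none P _).symm
    · refine (expect_sem_sem_le hP S (.loop r M S) (hC hρ).isFiniteState).trans (le_of_eq ?_)
      exact (postExpect_some_eq P (.seq S (.loop r M S)) (hC hρ).isFiniteState).symm
  intro ρ hρ
  refine ENNReal.le_of_forall_pos_le_add fun ε hε hfin => ?_
  clear hfin
  obtain ⟨t, ht⟩ := ht ε hε
  generalize hn : t ⟨ρ, hρ⟩ = n
  -- The state varies because the hypothesis is applied to the state after one more iteration.
  induction n using Nat.strong_induction_on generalizing ρ with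
  | _ n ih =>
    have hσ := isPartialDensity_sem S (hC hρ)
    have hdec := (ht ⟨ρ, hρ⟩ ⟨_, hσ⟩ rfl).2
    rw [hRρ hρ]
    by_cases hsmall : expect Q (C ∘L ρ ∘L C†) ≤ ε
    -- The recursion ends here, the only place where ε is spent: the exit branch alone is kept.
    · exact add_le_add (le_self_add.trans (hL hρ)) hsmall
    · have h1 : (ε : ℝ) ≤ (tr ((C† ∘L Q ∘L C) ∘L ρ)).re := by
        rw [re_tr_comp (conj_nonneg' hQ C) hρ.isFiniteState.1 hρ.isFiniteState.2,
          ← expect_conj hQ hρ.isFiniteState.1]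
        refine ENNReal.toReal_mono ?_ (le_of_not_ge hsmall)
        exact ne_top_of_le_ne_top (hC hρ).isFiniteState.2
          (expect_mono hQ hQ1 (hC hρ).isFiniteState.1)
      have h2 := ih _ (hn ▸ hdec h1) _ hσ rfl
      calc _ ≤ expect P (A ∘L ρ ∘L A†) + expect R (sem B S (C ∘L ρ ∘L C†)) := by
            gcongr
            exact h _ (hC hρ)
        _ ≤ expect P (A ∘L ρ ∘L A†) +
            (expect P (sem B (.loop r M S) (sem B S (C ∘L ρ ∘L C†))) + ε) := by gcongr
        _ ≤ _ := by
            rw [← add_assoc]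
            gcongr
            exact hL hρ

/-- In the initialization, unitary and measurement rules the precondition is the dual of the
transitions under `expect_conj`. Composition and order chain inequalities. -/
theorem Derivable.expectCorrect {P Q : Predicate B} {S : Prog ty} (h : Derivable P S Q) :
    ExpectCorrect P.1 S Q.1 := by
  induction h with
  | skip P =>
    intro ρ hρ
    rw [← postExpect_some_eq _ _ hρ.isFiniteState, postExpect_some]
    exact le_of_eq ((tsum_unit fun _ => postExpect P.1 none ρ).trans (postExpect_none _ _)).symm
  | init q P P' hP' =>
    intro ρ hρ
    rw [← postExpect_some_eq _ _ hρ.isFiniteState, postExpect_some]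
    -- `()` is the only label, so keeping one term loses nothing.
    refine le_trans (le_of_eq ?_) (ENNReal.le_tsum ())
    refine Eq.trans ?_ (postExpect_none P.1 (initState B q ρ)).symm
    have hadj : ∀ x, ketBraAt B q x (Register.zero _ ty) =
      (ketBraAt B q (Register.zero _ ty) x)† := fun x => (ketBraAt_adjoint B q _ _).symm
    rw [expect_initState q hρ.isFiniteState]
    simp_rw [expect_conj P.2.1 hρ.isFiniteState.1, ← hadj]
    refine expect_hasStrongSum (fun x => ?_) P'.2.1 hP' hρ.isFiniteState.1
    rw [hadj]
    exact conj_nonneg' P.2.1 _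
  | unitary r U hU P P' hP' =>
    intro ρ hρ
    rw [← postExpect_some_eq _ _ hρ.isFiniteState, postExpect_some]
    refine le_trans (le_of_eq ?_) (ENNReal.le_tsum ())
    refine Eq.trans ?_ (postExpect_none P.1 (cyl B r U ∘L ρ ∘L (cyl B r U)†)).symm
    rw [hP', expect_conj P.2.1 hρ.isFiniteState.1]
  | seq S₁ S₂ P Q R h₁ h₂ ih₁ ih₂ =>
    intro ρ hρ
    exact ((ih₁ ρ hρ).trans (ih₂ _ (isPartialDensity_sem S₁ hρ))).trans
      (expect_sem_sem_le R.2.1 S₁ S₂ hρ.isFiniteState)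
  | measure r M S P P' Q h hP' ih =>
    intro ρ hρ
    have hρ' := fun m => isPartialDensity_act (.measure r M S) m hρ
    rw [← postExpect_some_eq _ _ hρ.isFiniteState, postExpect_some,
      expect_hasStrongSum (fun m => conj_nonneg' (P m).2.1 _) P'.2.1 hP' hρ.isFiniteState.1]
    refine ENNReal.tsum_le_tsum fun m => ?_
    rw [← expect_conj (P m).2.1 hρ.isFiniteState.1]
    exact (ih m _ (hρ' m)).trans
      (le_of_eq (postExpect_some_eq Q.1 (S m) (hρ' m).isFiniteState).symm)
  | loop r M S P Q R hR h ht ih =>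
    exact expectCorrect_loop r M S P.2.1 Q.2.1 Q.2.2 hR ih ht
  | order S P P' Q Q' hP h hQ ih =>
    intro ρ hρ
    exact ((expect_mono P.2.1 hP hρ.isFiniteState.1).trans (ih ρ hρ)).trans
      (expect_mono Q'.2.1 hQ (isFiniteState_sem S hρ.isFiniteState).1)

end

end QHoare

theorem mainTheorem4 {Var : Type} [Countable Var] [Infinite Var] (ty : Var → QHoare.QType)
    (B : QHoare.ProductBasis ty) (S : QHoare.Prog ty) (P Q : QHoare.Predicate B)
    (h : QHoare.Derivable P S Q) :
    QHoare.TotallyCorrect P S Q :=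
  h.expectCorrect.totallyCorrect
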